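/- Let $(f_n)_{n\ge 0}$ be a sequence of real numbers satisfying a linear recurrence $$f_{n+h} = c_1 f_{n+h-1} + \dots + c_{h-1} f_{n+1} + c_h f_n, \qquad n \ge 0,$$ with constant coefficients $c_1,\dots,c_h\in\mathbb{R}$. Then the zero set $\{n\in\mathbb{N} : f_n = 0\}$ has a natural density, that is, the limit $$\lim_{x\to\infty} \frac{1}{x}\,\#\{n\in\mathbb{N} : n\le x,\ f_n=0\}$$ exists, and this density is a rational number. -/

import Mathlib

/-- The set `A` of natural numbers has natural density `δ`: the limit of
`#{n ≤ x : n ∈ A} / x`, as the real number `x` tends to infinity, exists and equals `δ`. -/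
def HasNaturalDensity (A : Set ℕ) (δ : ℝ) : Prop :=
  Filter.Tendsto (fun x : ℝ => x⁻¹ * (Set.ncard {n : ℕ | (n : ℝ) ≤ x ∧ n ∈ A} : ℝ))
    Filter.atTop (nhds δ)

/-! Let `G` be the union of the residue classes modulo a fixed `D` on which `f` vanishes
identically. It is periodic, so its density is rational; the point is that the other zeros have
density 0.

After removing trailing zero coefficients, `f` lives in a finitely generated domain where the last
coefficient is a unit. Powers `I l` of a maximal ideal have finite quotients and zero intersection,
and `f` is purely periodic modulo each. The sets of `n ∉ G` with `f n ∈ I l` are periodic and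
decreasing. If their densities stayed above some `ε > 0`, `exists_progression_of_periodic` would put
long progressions of one fixed difference in all late sets. By Cayley–Hamilton
(`eq_zero_of_forall_lt_order`) `f` then vanishes modulo `I l` on whole progressions; by pigeonhole
one residue class serves infinitely many `l`, so `f` vanishes there. The choice of `D`
(`exists_modulus`) forces that class into `G`, a contradiction. -/

namespace LinearRecurrence

open Finset

/-! ### Recurrences over rings: progressions and periodicity -/

section CommRing

variable {R : Type*} [CommRing R] {E : LinearRecurrence R} {f : ℕ → R}

theorem IsSolution.tupleSucc_apply (hf : E.IsSolution f) (n : ℕ) :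
    E.tupleSucc (fun i => f (n + i)) = fun i : Fin E.order => f (n + 1 + i) := by
  funext i
  simp only [tupleSucc, LinearMap.coe_mk, AddHom.coe_mk]
  split_ifs with h
  · congr 1; ring
  · rw [← hf n]
    congr 1
    have := i.2
    omega

theorem IsSolution.tupleSucc_pow_apply (hf : E.IsSolution f) (k n : ℕ) :
    (E.tupleSucc ^ k) (fun i => f (n + i)) = fun i : Fin E.order => f (n + k + i) := by
  induction k with
  | zero => simp
  | succ k ih => rw [pow_succ', Module.End.mul_apply, ih, hf.tupleSucc_apply]; rfl

/-- A solution vanishing at `E.order` consecutive terms of an arithmetic progression vanishes on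
the rest of the progression. -/
theorem IsSolution.eq_zero_of_forall_lt_order (hf : E.IsSolution f) {x d : ℕ}
    (h0 : ∀ i < E.order, f (x + d * i) = 0) (n : ℕ) : f (x + d * n) = 0 := by
  nontriviality R
  rcases Nat.eq_zero_or_pos E.order with hE | hE
  · have : IsEmpty (Fin E.order) := by rw [hE]; infer_instance
    have := hf (x + d * n)
    simpa [hE] using this
  set φ := E.tupleSucc ^ d with hφ
  have hφn : ∀ k y, (φ ^ k) (fun i => f (y + i)) =
      fun i : Fin E.order => f (y + d * k + i) := fun k y => by
    rw [hφ, ← pow_mul, hf.tupleSucc_pow_apply]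
  have hdeg : φ.charpoly.natDegree = E.order := by
    rw [LinearMap.charpoly_natDegree, Module.finrank_fin_fun]
  -- Cayley–Hamilton for the `d`-th power of the companion map, read in the first coordinate, is a
  -- monic recurrence of the same order along the progression.
  have hrec : ∀ y, ∑ k ∈ range (E.order + 1), φ.charpoly.coeff k * f (y + d * k) = 0 := by
    intro y
    have h := congrArg (fun ψ : Module.End R (Fin E.order → R) =>
      ψ (fun i => f (y + i)) ⟨0, hE⟩) φ.aeval_self_charpoly
    simpa [Polynomial.aeval_eq_sum_range, hdeg, hφn] using h
  have hmonic : φ.charpoly.coeff E.order = 1 := by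
    have h := φ.charpoly_monic.coeff_natDegree
    rwa [hdeg] at h
  induction n using Nat.strong_induction_on with
  | _ n ih =>
    rcases lt_or_ge n E.order with hn | hn
    · exact h0 n hn
    obtain ⟨m, rfl⟩ := Nat.exists_eq_add_of_le' hn
    have h := hrec (x + d * m)
    rw [sum_range_succ, hmonic, one_mul, sum_eq_zero, zero_add] at h
    · rw [mul_add, ← add_assoc, h]
    · intro k hk
      rw [add_assoc, ← mul_add, ih _ (by simpa using hk), mul_zero]

/-- A solution in a finite ring is purely periodic when the last coefficient is invertible. -/
theorem IsSolution.exists_periodic [Finite R] (hf : E.IsSolution f)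
    (hE : ∀ h : 0 < E.order, IsUnit (E.coeffs ⟨0, h⟩)) :
    ∃ N > 0, Function.Periodic f N := by
  rcases Nat.eq_zero_or_pos E.order with h | h
  · have : IsEmpty (Fin E.order) := by rw [h]; infer_instance
    have h0 : ∀ n, f n = 0 := fun n => by simpa [h] using hf n
    exact ⟨1, one_pos, fun n => by simp [h0]⟩
  -- The invertible coefficient lets the recurrence run backwards, so a repeated state can be traced
  -- back to index 0.
  have hinj : ∀ i j, (fun k : Fin E.order => f (i + 1 + k)) = (fun k : Fin E.order => f (j + 1 + k)) →
      (fun k : Fin E.order => f (i + k)) = (fun k : Fin E.order => f (j + k)) := by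
    intro i j hij
    have key : ∀ k < E.order, f (i + 1 + k) = f (j + 1 + k) :=
      fun k hk => congrFun hij ⟨k, hk⟩
    have hsucc : ∀ k, 0 < k → k ≤ E.order → f (i + k) = f (j + k) := by
      intro k hk hk'
      have := key (k - 1) (by omega)
      rwa [show i + 1 + (k - 1) = i + k by omega, show j + 1 + (k - 1) = j + k by omega] at this
    have h1 := hsucc E.order h le_rfl
    rw [hf i, hf j, ← add_sum_erase _ _ (mem_univ ⟨0, h⟩),
      ← add_sum_erase _ _ (mem_univ (⟨0, h⟩ : Fin E.order)),
      sum_congr rfl (g := fun k : Fin E.order => E.coeffs k * f (j + k))] at h1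
    · have h2 := (hE h).mul_left_cancel (add_right_cancel h1)
      funext k
      rcases Nat.eq_zero_or_pos k.1 with h0 | h0
      · rw [h0]; exact h2
      · exact hsucc k h0 k.2.le
    · intro k hk
      have hk' : k.1 ≠ 0 := fun h0 => (mem_erase.1 hk).1 (Fin.ext h0)
      rw [hsucc k (by omega) k.2.le]
  obtain ⟨a, b, hab, hfab⟩ := Finite.exists_ne_map_eq_of_infinite
    (fun n : ℕ => (fun k : Fin E.order => f (n + k)))
  wlog hlt : a < b generalizing a b
  · exact this b a hab.symm hfab.symm (by omega)
  have hback : ∀ c, ∀ i j, (fun k : Fin E.order => f (i + c + k)) = (fun k : Fin E.order => f (j + c + k)) →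
      (fun k : Fin E.order => f (i + k)) = (fun k : Fin E.order => f (j + k)) := by
    intro c
    induction c with
    | zero => intro i j hij; exact hij
    | succ c ih => intro i j hij; exact ih i j (hinj _ _ hij)
  have h0 := hback a 0 (b - a) (by
    rw [zero_add, Nat.sub_add_cancel hlt.le]; exact hfab)
  refine ⟨b - a, by omega, fun n => ?_⟩
  have h1 := congrArg (E.tupleSucc ^ n) h0
  rw [hf.tupleSucc_pow_apply, hf.tupleSucc_pow_apply] at h1
  have h2 := congrFun h1 ⟨0, h⟩
  simp only [zero_add, add_zero] at h2
  rw [add_comm, h2]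

end CommRing

/-! ### Recurrences over fields: the modulus `D` -/

section Field

variable {K : Type*} [Field K] {E : LinearRecurrence K} {f : ℕ → K}

/-- There is a modulus `D` such that a solution vanishing on a residue class modulo a multiple of
`D` vanishes on the residue class modulo `D` containing it. -/
theorem IsSolution.exists_modulus (hf : E.IsSolution f) :
    ∃ D > 0, ∀ e > 0, ∀ r, (∀ n, f (r + D * e * n) = 0) → ∀ n, f (r + D * n) = 0 := by
  let V : ℕ → Submodule K (ℕ → K) := fun d => Submodule.span K (Set.range fun n m => f (m + d * n))
  have hmem : ∀ d n, (fun m => f (m + d * n)) ∈ V d :=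
    fun d n => Submodule.subset_span ⟨n, rfl⟩
  have hsol : ∀ d, V d ≤ E.solSpace := by
    intro d
    rw [Submodule.span_le]
    rintro _ ⟨n, rfl⟩ m
    have := hf (m + d * n)
    beta_reduce
    rw [add_right_comm, this]
    exact sum_congr rfl fun i _ => by rw [add_right_comm]
  have : FiniteDimensional K E.solSpace := Module.Finite.of_basis E.basis
  have hfin : ∀ d, FiniteDimensional K (V d) := fun d => Submodule.finiteDimensional_of_le (hsol d)
  -- `D` minimises the dimension of the span of the shifts of `f` by multiples of `d`. Passing to `D
  -- * e` cannot shrink the span, so evaluation at `r` kills one span exactly when it kills the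
  -- other.
  obtain ⟨D, hD, hmin⟩ := (measure fun d => Module.finrank K (V d)).wf.has_min {d | 0 < d}
    ⟨1, Nat.one_pos⟩
  refine ⟨D, hD, fun e he r hr n => ?_⟩
  have hle : V (D * e) ≤ V D := by
    refine Submodule.span_le.2 ?_
    rintro _ ⟨n, rfl⟩
    simp only [mul_assoc D e]
    exact hmem D (e * n)
  have heq : V (D * e) = V D :=
    Submodule.eq_of_le_of_finrank_le hle (not_lt.1 (hmin (D * e) (Nat.mul_pos hD he)))
  have hker : V (D * e) ≤ LinearMap.ker (LinearMap.proj r : (ℕ → K) →ₗ[K] K) := by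
    refine Submodule.span_le.2 ?_
    rintro _ ⟨n, rfl⟩
    exact hr n
  exact hker (heq ▸ hmem D n)

end Field

end LinearRecurrence

/-! ### Counting in periodic sets -/

theorem Nat.count_mul_of_periodic {p : ℕ → Prop} [DecidablePred p] {N : ℕ}
    (hp : Function.Periodic p N) (k : ℕ) : Nat.count p (N * k) = k * Nat.count p N := by
  induction k with
  | zero => simp
  | succ k ih =>
    have h : (fun j => p (N * k + j)) = p := by
      funext j
      rw [add_comm, mul_comm]
      exact hp.nat_mul k j
    rw [Nat.mul_succ, Nat.count_add, ih, Nat.succ_mul]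
    congr 1
    simp only [h]

theorem Nat.count_shift_of_periodic {p : ℕ → Prop} [DecidablePred p] {N : ℕ}
    (hp : Function.Periodic p N) (a : ℕ) : Nat.count (fun n => p (n + a)) N = Nat.count p N := by
  have h1 := Nat.count_add p a N
  have h2 := Nat.count_add p N a
  have h3 : (fun k => p (N + k)) = p := by
    funext k; rw [add_comm]; exact hp k
  simp only [h3] at h2
  simp only [add_comm _ a]
  rw [add_comm a N] at h1
  omega

/-- Number of elements below `n` of an `N`-periodic set, up to an error `N`. -/
theorem Nat.abs_count_sub_le_of_periodic {p : ℕ → Prop} [DecidablePred p] {N : ℕ} (hN : 0 < N)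
    (hp : Function.Periodic p N) (n : ℕ) :
    |(Nat.count p n : ℝ) - (Nat.count p N : ℝ) / N * n| ≤ N := by
  have hN' : (0 : ℝ) < N := by exact_mod_cast hN
  have hc : Nat.count p N ≤ N := Nat.count_le _
  have h1 : Nat.count p (N * (n / N)) ≤ Nat.count p n :=
    Nat.count_monotone p (Nat.mul_div_le n N)
  have h2 : Nat.count p n ≤ Nat.count p (N * (n / N + 1)) :=
    Nat.count_monotone p (Nat.lt_mul_div_succ n hN).le
  rw [Nat.count_mul_of_periodic hp] at h1 h2
  have h3 : N * (n / N) ≤ n := Nat.mul_div_le n N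
  have h4 : n ≤ N * (n / N + 1) := (Nat.lt_mul_div_succ n hN).le
  generalize n / N = q at *
  generalize Nat.count p N = c at *
  generalize Nat.count p n = t at *
  have h1' : (q : ℝ) * c ≤ t := by exact_mod_cast h1
  have h2' : (t : ℝ) ≤ (q + 1) * c := by exact_mod_cast h2
  have h3' : (N : ℝ) * q ≤ n := by exact_mod_cast h3
  have h4' : (n : ℝ) ≤ N * (q + 1) := by exact_mod_cast h4
  have hc' : (c : ℝ) ≤ N := by exact_mod_cast hc
  have hc0 : (0 : ℝ) ≤ c / N := by positivity
  have e1 : (c : ℝ) / N * (N * q) = q * c := by field_simp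
  have e2 : (c : ℝ) / N * (N * (q + 1)) = (q + 1) * c := by field_simp
  have h5 := mul_le_mul_of_nonneg_left h3' hc0
  have h6 := mul_le_mul_of_nonneg_left h4' hc0
  rw [abs_le]
  constructor <;> nlinarith

/-! ### Density -/

open Classical in
/-- Counting form of natural density. -/
def HasCountDensity (A : Set ℕ) (δ : ℝ) : Prop :=
  ∀ ε > 0, ∃ C : ℝ, ∀ n : ℕ, |(Nat.count (· ∈ A) n : ℝ) - δ * n| ≤ ε * n + C

open Classical in
theorem HasCountDensity.hasNaturalDensity {A : Set ℕ} {δ : ℝ} (h : HasCountDensity A δ) :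
    HasNaturalDensity A δ := by
  have hcard : ∀ x : ℝ, 0 ≤ x → Set.ncard {n : ℕ | (n : ℝ) ≤ x ∧ n ∈ A} =
      Nat.count (· ∈ A) (⌊x⌋₊ + 1) := by
    intro x hx
    rw [Nat.count_eq_card_filter_range, ← Set.ncard_coe_finset]
    congr 1
    ext n
    simp [Nat.le_floor_iff hx]
  unfold HasNaturalDensity
  rw [Metric.tendsto_atTop]
  intro ε hε
  obtain ⟨C, hC⟩ := h (ε / 2) (half_pos hε)
  -- Beyond this threshold `ε / 2 * x` absorbs the constant and the rounding of `x`.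
  refine ⟨max 1 ((ε / 2 + C + |δ|) / (ε / 2) + 1), fun x hx => ?_⟩
  have hx1 : 1 ≤ x := le_trans (le_max_left _ _) hx
  have hx0 : 0 < x := by linarith
  have hx2 : (ε / 2 + C + |δ|) / (ε / 2) < x :=
    lt_of_lt_of_le (by linarith) (le_trans (le_max_right _ _) hx)
  rw [div_lt_iff₀ (half_pos hε)] at hx2
  rw [Real.dist_eq, hcard x hx0.le]
  have h1 := hC (⌊x⌋₊ + 1)
  push_cast at h1
  have h2 := Nat.floor_le hx0.le
  have h3 := Nat.lt_floor_add_one x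
  generalize (Nat.count (· ∈ A) (⌊x⌋₊ + 1) : ℝ) = t at *
  generalize (⌊x⌋₊ : ℝ) = y at *
  have h4 : |t - δ * x| < ε * x := by
    have h5 : |δ * (y + 1 - x)| ≤ |δ| := by
      rw [abs_mul]
      exact mul_le_of_le_one_right (abs_nonneg _) (abs_le.2 ⟨by linarith, by linarith⟩)
    calc |t - δ * x| = |(t - δ * (y + 1)) + δ * (y + 1 - x)| := by congr 1; ring
      _ ≤ (ε / 2 * (y + 1) + C) + |δ| := (abs_add_le _ _).trans (add_le_add h1 h5)
      _ < ε * x := by nlinarith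
  have h6 : x⁻¹ * t - δ = x⁻¹ * (t - δ * x) := by field_simp
  rw [h6, abs_mul, abs_of_pos (inv_pos.2 hx0), inv_mul_lt_iff₀ hx0, mul_comm x]
  exact h4

open Classical in
theorem HasCountDensity.of_shift {A : Set ℕ} {δ : ℝ} {s : ℕ}
    (h : HasCountDensity {n | n + s ∈ A} δ) : HasCountDensity A δ := by
  intro ε hε
  obtain ⟨C, hC⟩ := h ε hε
  refine ⟨C + s + |δ| * s + ε * s, fun n => ?_⟩
  have h1 := hC n
  have h2 := Nat.count_add' (· ∈ A) n s
  have h3 := Nat.count_add (· ∈ A) n s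
  have h4 : Nat.count (· ∈ A) s ≤ s := Nat.count_le _
  have h5 : Nat.count (fun k => n + k ∈ A) s ≤ s := Nat.count_le _
  simp only [Set.mem_ofPred_eq] at h1
  rw [h2] at h3
  have h3' : (Nat.count (fun k => k + s ∈ A) n : ℝ) + Nat.count (· ∈ A) s =
    Nat.count (· ∈ A) n + Nat.count (fun k => n + k ∈ A) s := by exact_mod_cast h3
  have h4' : (Nat.count (· ∈ A) s : ℝ) ≤ s := by exact_mod_cast h4
  have h5' : (Nat.count (fun k => n + k ∈ A) s : ℝ) ≤ s := by exact_mod_cast h5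
  have h6 : (0 : ℝ) ≤ Nat.count (· ∈ A) s := by positivity
  have h7 : (0 : ℝ) ≤ Nat.count (fun k => n + k ∈ A) s := by positivity
  have h8 : 0 ≤ |δ| * s := by positivity
  have h9 : 0 ≤ ε * s := by positivity
  rw [abs_le] at h1 ⊢
  constructor <;> linarith

/-! ### Progressions in decreasing periodic sets -/

open Classical in
/-- A decreasing sequence of periodic sets, each of density at least `δ > 0`: for some `k` all the
later sets contain progressions of length `h` whose difference is the `k`-th period. -/
theorem exists_progression_of_periodic {Z : ℕ → Set ℕ} {N : ℕ → ℕ} (hN : ∀ l, 0 < N l)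
    (hdvd : ∀ k l, k ≤ l → N k ∣ N l) (hZ : Antitone Z)
    (hper : ∀ l, Function.Periodic (· ∈ Z l) (N l)) {δ : ℝ} (hδ : 0 < δ)
    (hdens : ∀ l, δ ≤ (Nat.count (· ∈ Z l) (N l) : ℝ) / N l) (h : ℕ) :
    ∃ k, ∀ l, k ≤ l → ∃ x, ∀ i < h, x + N k * i ∈ Z l := by
  set ρ : ℕ → ℝ := fun l => (Nat.count (· ∈ Z l) (N l) : ℝ) / N l with hρ
  have hN' : ∀ l, (0 : ℝ) < N l := fun l => by exact_mod_cast hN l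
  have hbdd : BddBelow (Set.range ρ) := ⟨δ, by rintro _ ⟨l, rfl⟩; exact hdens l⟩
  set μ := ⨅ l, ρ l with hμ
  have hμδ : δ ≤ μ := le_ciInf hdens
  have hh : (0 : ℝ) < h + 1 := by positivity
  -- From `k` on, the density drops by less than `δ / (h + 1)`, so `h` translates of `Z k \ Z l` are
  -- too sparse to cover `Z k`.
  obtain ⟨k, hk⟩ := exists_lt_of_ciInf_lt (show ⨅ l, ρ l < μ + δ / (h + 1) by
    rw [← hμ]; linarith [div_pos hδ hh])
  refine ⟨k, fun l hl => ?_⟩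
  obtain ⟨e, he⟩ := hdvd k l hl
  have hperk : Function.Periodic (· ∈ Z k) (N l) := by
    rw [he, mul_comm]; exact (hper k).nat_mul e
  have hck : (Nat.count (· ∈ Z k) (N l) : ℝ) = ρ k * N l := by
    rw [he, Nat.count_mul_of_periodic (hper k), hρ]
    have := (hN' k).ne'
    push_cast; field_simp
  have hcl : (Nat.count (· ∈ Z l) (N l) : ℝ) = ρ l * N l := by
    have := (hN' l).ne'
    rw [hρ]; field_simp
  by_contra! hcon
  have hbad : ∀ i, Nat.count (fun x => x ∈ Z k ∧ x + N k * i ∉ Z l) (N l) +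
      Nat.count (· ∈ Z l) (N l) = Nat.count (· ∈ Z k) (N l) := by
    intro i
    have hdiff : Function.Periodic (fun x => x ∈ Z k ∧ x ∉ Z l) (N l) := by
      intro x
      simp only [hperk x, hper l x]
    have h1 := Nat.count_shift_of_periodic hdiff (N k * i)
    have h2 : ∀ x, (x + N k * i ∈ Z k) = (x ∈ Z k) := fun x => by
      rw [mul_comm]; exact (hper k).nat_mul i x
    simp only [h2] at h1
    rw [h1, Nat.count_eq_card_filter_range, Nat.count_eq_card_filter_range,
      Nat.count_eq_card_filter_range, ← Finset.card_union_of_disjoint]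
    · congr 1
      ext x
      have := @hZ k l hl x
      simp only [Finset.mem_union, Finset.mem_filter, Finset.mem_range]
      tauto
    · rw [Finset.disjoint_left]
      intro x
      simp only [Finset.mem_filter]
      tauto
  have hsum : Nat.count (· ∈ Z k) (N l) ≤
      ∑ i ∈ Finset.range h, Nat.count (fun x => x ∈ Z k ∧ x + N k * i ∉ Z l) (N l) := by
    simp only [Nat.count_eq_card_filter_range]
    refine le_trans (Finset.card_le_card ?_) Finset.card_biUnion_le
    intro x hx
    obtain ⟨i, hi, hxi⟩ := hcon x
    simp only [Finset.mem_filter, Finset.mem_biUnion, Finset.mem_range] at hx ⊢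
    exact ⟨i, hi, hx.1, hx.2, hxi⟩
  have hsum' : ρ k * N l ≤ h * ((ρ k - ρ l) * N l) := by
    rw [← hck]
    refine le_trans (by exact_mod_cast hsum : (Nat.count (· ∈ Z k) (N l) : ℝ) ≤
      ((∑ i ∈ Finset.range h, Nat.count (fun x => x ∈ Z k ∧ x + N k * i ∉ Z l) (N l) : ℕ) : ℝ)) ?_
    push_cast
    refine le_trans (Finset.sum_le_card_nsmul _ _ ((ρ k - ρ l) * N l) fun i _ => ?_) (by simp)
    have : (Nat.count (fun x => x ∈ Z k ∧ x + N k * i ∉ Z l) (N l) : ℝ) +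
      Nat.count (· ∈ Z l) (N l) = Nat.count (· ∈ Z k) (N l) := by exact_mod_cast hbad i
    rw [sub_mul, ← hck, ← hcl]
    linarith
  have h1 : ρ k ≤ h * (ρ k - ρ l) := by
    rw [← mul_assoc] at hsum'
    exact le_of_mul_le_mul_right hsum' (hN' l)
  have h2 : μ ≤ ρ l := ciInf_le hbdd l
  have h3 : μ ≤ ρ k := ciInf_le hbdd k
  have h4 : ρ k - ρ l < δ / (h + 1) := by linarith
  have h5 : (h : ℝ) * (ρ k - ρ l) ≤ h * (δ / (h + 1)) :=
    mul_le_mul_of_nonneg_left h4.le (by positivity)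
  have h6 : (h : ℝ) * (δ / (h + 1)) < δ := by
    rw [mul_div_assoc', div_lt_iff₀ hh]; nlinarith
  linarith

/-! ### Density of zeros by reduction modulo ideals -/

open Classical in
/-- The zero set of a solution in a residually finite ring has a rational density. -/
theorem LinearRecurrence.IsSolution.exists_hasCountDensity_of_residuallyFinite
    {R : Type*} [CommRing R] {E : LinearRecurrence R} {f : ℕ → R} (hf : E.IsSolution f)
    (hE : ∀ h : 0 < E.order, IsUnit (E.coeffs ⟨0, h⟩))
    {I : ℕ → Ideal R} (hI : Antitone I) [hfin : ∀ l, Finite (R ⧸ I l)] (hinf : ⨅ l, I l = ⊥)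
    {D : ℕ} (hD : 0 < D)
    (hmod : ∀ e > 0, ∀ r, (∀ n, f (r + D * e * n) = 0) → ∀ n, f (r + D * n) = 0) :
    ∃ q : ℚ, HasCountDensity {n | f n = 0} (q : ℝ) := by
  let F : (l : ℕ) → LinearRecurrence (R ⧸ I l) :=
    fun l => ⟨E.order, fun i => Ideal.Quotient.mk (I l) (E.coeffs i)⟩
  have hF : ∀ l, (F l).IsSolution fun n => Ideal.Quotient.mk (I l) (f n) := by
    intro l n
    change Ideal.Quotient.mk (I l) (f (n + E.order)) = _
    rw [hf n, map_sum]
    simp [F]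
  have hp : ∀ l, ∃ N > 0, Function.Periodic (fun n => Ideal.Quotient.mk (I l) (f n)) N :=
    fun l => (hF l).exists_periodic fun h => (hE h).map (Ideal.Quotient.mk (I l))
  choose p hp0 hp using hp
  -- The product makes the periods divide one another; the factor `D` makes them periods of `G` too.
  let N : ℕ → ℕ := fun l => D * ∏ i ∈ Finset.range (l + 1), p i
  have hN : ∀ l, 0 < N l := fun l => Nat.mul_pos hD (Finset.prod_pos fun i _ => hp0 i)
  have hdvd : ∀ k l, k ≤ l → N k ∣ N l := fun k l hkl =>
    mul_dvd_mul_left D (Finset.prod_dvd_prod_of_subset _ _ _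
      (Finset.range_subset_range.2 (by omega)))
  have hDN : ∀ l, D ∣ N l := fun l => dvd_mul_right _ _
  have hfN : ∀ l, Function.Periodic (fun n => f n ∈ I l) (N l) := by
    intro l n
    obtain ⟨e, he⟩ : p l ∣ N l :=
      (Finset.dvd_prod_of_mem p (Finset.self_mem_range_succ l)).trans (dvd_mul_left _ _)
    have h : Ideal.Quotient.mk (I l) (f (n + N l)) = Ideal.Quotient.mk (I l) (f n) := by
      rw [he, mul_comm]; exact (hp l).nat_mul e n
    simp only [← Ideal.Quotient.eq_zero_iff_mem, h]
  let G : Set ℕ := {n | ∀ k, f (n % D + D * k) = 0}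
  have hGD : Function.Periodic (· ∈ G) D := fun n => by simp [G]
  have hGN : ∀ l, Function.Periodic (· ∈ G) (N l) := fun l => by
    obtain ⟨e, he⟩ := hDN l
    rw [he, mul_comm]; exact hGD.nat_mul e
  have hG0 : ∀ n ∈ G, f n = 0 := fun n hn => by
    have := hn (n / D)
    rwa [Nat.mod_add_div] at this
  let Z : ℕ → Set ℕ := fun l => {n | n ∉ G ∧ f n ∈ I l}
  have hZ : Antitone Z := fun k l hkl n hn => ⟨hn.1, hI hkl hn.2⟩
  have hper : ∀ l, Function.Periodic (· ∈ Z l) (N l) := by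
    intro l n
    have h1 := hGN l n
    have h2 := hfN l n
    simp only [Z, Set.mem_ofPred_eq] at h1 h2 ⊢
    simp only [h1, h2]
  have hsmall : ∀ ε > (0 : ℝ), ∃ l, (Nat.count (· ∈ Z l) (N l) : ℝ) / N l < ε := by
    intro ε hε
    by_contra! hcon
    -- Length `E.order + 1` guarantees a term at `i = 0` even for order 0, so that `x ∉ G` can be
    -- read off.
    obtain ⟨k, hk⟩ := exists_progression_of_periodic hN hdvd hZ hper hε
      (fun l => (hcon l).trans_eq (by congr!)) (E.order + 1)
    have hclass : ∀ l, ∃ r : Fin (N k), (r : ℕ) ∉ G ∧ ∀ n, f (r + N k * n) ∈ I l := by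
      intro l
      obtain ⟨x, hx⟩ := hk (max k l) (le_max_left _ _)
      have hxG : x ∉ G := by simpa using (hx 0 (Nat.succ_pos _)).1
      have hall : ∀ n, f (x + N k * n) ∈ I (max k l) := by
        intro n
        rw [← Ideal.Quotient.eq_zero_iff_mem]
        exact (hF (max k l)).eq_zero_of_forall_lt_order (fun i hi =>
          Ideal.Quotient.eq_zero_iff_mem.2 (hx i (Nat.lt_succ_of_lt hi)).2) n
      refine ⟨⟨x % N k, Nat.mod_lt _ (hN k)⟩, ?_, fun n => ?_⟩
      · simpa [G, Nat.mod_mod_of_dvd x (hDN k)] using hxG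
      · apply hI (le_max_right k l)
        have h1 := hfN (max k l)
        obtain ⟨e, he⟩ := hdvd k (max k l) (le_max_left _ _)
        have h2 := h1.nat_mul (x / N k) (x % N k + N k * n)
        simp only [Nat.cast_id] at h2
        rw [← h2]
        -- Adding a multiple of the period moves the index past `x`, where vanishing modulo the
        -- ideal is known.
        have h3 : x % N k + N k * n + x / N k * N (max k l) =
            x % N k + N k * (x / N k) + N k * (n + x / N k * e - x / N k) := by
          have h4 : x / N k ≤ n + x / N k * e := by
            have : 0 < e := Nat.pos_of_ne_zero fun h0 => (hN (max k l)).ne' (by rw [he, h0, mul_zero])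
            nlinarith [Nat.zero_le (x / N k)]
          rw [he, add_assoc _ (N k * (x / N k)), ← mul_add, Nat.add_sub_cancel' h4]
          ring
        rw [h3, Nat.mod_add_div]
        exact hall _
    choose r hrG hr using hclass
    obtain ⟨r₀, hr₀⟩ := Finite.exists_infinite_fiber r
    have hzero : ∀ n, f (r₀ + N k * n) = 0 := by
      intro n
      rw [← Ideal.mem_bot, ← hinf, Ideal.mem_iInf]
      intro l
      obtain ⟨l', hl', hll'⟩ := (Set.infinite_coe_iff.1 hr₀).exists_gt l
      have h := hr l' n
      rw [show r l' = r₀ from hl'] at h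
      exact hI hll'.le h
    obtain ⟨e, he⟩ := hDN k
    have hD0 := hmod e (Nat.pos_of_ne_zero fun h0 => (hN k).ne' (by rw [he, h0, mul_zero])) r₀
      (by rw [← he]; exact hzero)
    obtain ⟨l, hl⟩ := (Set.infinite_coe_iff.1 hr₀).nonempty
    -- `hD0` covers only indices from `r₀` on; the earlier ones in the class follow by periodicity
    -- modulo each `I m`.
    refine hrG l fun n => ?_
    rw [show r l = r₀ from hl]
    rw [← Ideal.mem_bot, ← hinf, Ideal.mem_iInf]
    intro m
    obtain ⟨c, hc⟩ := hDN m
    have h1 := (hfN m).nat_mul r₀ (r₀ % D + D * n)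
    simp only [Nat.cast_id] at h1
    rw [← h1]
    have h2 : (r₀ : ℕ) / D ≤ n + r₀ * c := by
      have : 0 < c := Nat.pos_of_ne_zero fun h0 => (hN m).ne' (by rw [hc, h0, mul_zero])
      exact (Nat.div_le_self _ _).trans ((Nat.le_mul_of_pos_right _ this).trans (Nat.le_add_left _ _))
    have h3 : (r₀ : ℕ) % D + D * n + r₀ * N m =
        r₀ % D + D * (r₀ / D) + D * (n + r₀ * c - r₀ / D) := by
      rw [add_assoc (_ % D) (D * (_ / D)), ← mul_add, Nat.add_sub_cancel' h2, hc]
      ring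
    rw [h3, Nat.mod_add_div, hD0]
    exact zero_mem _
  refine ⟨(Nat.count (· ∈ G) D : ℚ) / D, fun ε hε => ?_⟩
  obtain ⟨l, hl⟩ := hsmall ε hε
  refine ⟨D + N l, fun n => ?_⟩
  have h1 := abs_le.1 (Nat.abs_count_sub_le_of_periodic hD hGD n)
  have h2 := abs_le.1 (Nat.abs_count_sub_le_of_periodic (hN l) (hper l) n)
  have h3 : Nat.count (· ∈ G) n ≤ Nat.count (· ∈ {n | f n = 0}) n :=
    Nat.count_mono_left fun k _ hk => hG0 k hk
  have h4 : Nat.count (· ∈ {n | f n = 0}) n ≤ Nat.count (· ∈ G) n + Nat.count (· ∈ Z l) n := by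
    simp only [Nat.count_eq_card_filter_range]
    refine le_trans (Finset.card_le_card fun k hk => ?_) (Finset.card_union_le _ _)
    simp only [Finset.mem_filter, Finset.mem_union, Set.mem_ofPred_eq, Z] at hk ⊢
    by_cases hkG : k ∈ G
    · exact Or.inl ⟨hk.1, hkG⟩
    · exact Or.inr ⟨hk.1, hkG, by rw [hk.2]; exact zero_mem _⟩
  have h3' : (Nat.count (· ∈ G) n : ℝ) ≤ Nat.count (· ∈ {n | f n = 0}) n := by exact_mod_cast h3
  have h4' : (Nat.count (· ∈ {n | f n = 0}) n : ℝ) ≤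
    Nat.count (· ∈ G) n + Nat.count (· ∈ Z l) n := by exact_mod_cast h4
  have h5 : (Nat.count (· ∈ Z l) (N l) : ℝ) / N l * n ≤ ε * n :=
    mul_le_mul_of_nonneg_right hl.le (Nat.cast_nonneg n)
  have h6 : 0 ≤ ε * n := by positivity
  have h7 : (0 : ℝ) ≤ N l := by positivity
  push_cast
  rw [abs_le]
  constructor <;> linarith

/-! ### Residual finiteness of finitely generated domains -/

instance Int.isJacobsonRing : IsJacobsonRing ℤ := by
  rw [isJacobsonRing_iff_prime_eq]
  intro P hP
  by_cases h : P = ⊥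
  · subst h
    refine le_antisymm (fun x hx => ?_) Ideal.le_jacobson
    rw [Ideal.mem_jacobson_bot] at hx
    -- Here `x * x + 1` is a unit, which forces `x = 0`.
    have h1 := Int.isUnit_iff.1 (hx x)
    rw [Ideal.mem_bot]
    rcases h1 with h1 | h1 <;> nlinarith
  · have := hP.isMaximal h
    exact Ideal.jacobson_eq_self_of_isMaximal

/-- A field that is finitely generated as a ring is finite. -/
theorem finite_of_surjective_of_finiteType_int {R K : Type*} [CommRing R] [Algebra.FiniteType ℤ R]
    [Field K] (φ : R →+* K) (hφ : Function.Surjective φ) : Finite K := by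
  have : Algebra.FiniteType ℤ K := .of_surjective φ.toIntAlgHom hφ
  have hfin : Module.Finite ℤ K := finite_of_finite_type_of_isJacobsonRing ℤ K
  -- Otherwise `ℤ`, lying under a field integral over it, would be a field.
  have hinj : ¬ Function.Injective (algebraMap ℤ K) := by
    intro h
    have := Algebra.IsIntegral.of_finite ℤ K
    exact Int.not_isField (isField_of_isIntegral_of_isField h (Field.toIsField K))
  rw [injective_iff_map_eq_zero] at hinj
  push Not at hinj
  obtain ⟨a, ha, ha0⟩ := hinj
  refine Module.finite_of_fg_torsion K fun x => ?_
  refine ⟨⟨a, mem_nonZeroDivisors_of_ne_zero ha0⟩, ?_⟩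
  change a • x = 0
  rw [Algebra.smul_def, ha, zero_mul]

/-- A domain finitely generated over `ℤ` is residually finite. -/
theorem exists_antitone_ideal_of_finiteType_int (R : Type*) [CommRing R] [IsDomain R]
    [Algebra.FiniteType ℤ R] :
    ∃ I : ℕ → Ideal R, Antitone I ∧ (∀ l, Finite (R ⧸ I l)) ∧ ⨅ l, I l = ⊥ := by
  have : IsNoetherianRing R := Algebra.FiniteType.isNoetherianRing ℤ R
  obtain ⟨m, hm⟩ := Ideal.exists_maximal R
  let := Ideal.Quotient.field m
  have : Finite (R ⧸ m) :=
    finite_of_surjective_of_finiteType_int (Ideal.Quotient.mk m) Ideal.Quotient.mk_surjective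
  exact ⟨fun l => m ^ l, fun a b h => Ideal.pow_le_pow_right h,
    fun l => Ideal.finite_quotient_pow (IsNoetherian.noetherian m) l,
    Ideal.iInf_pow_eq_bot_of_isDomain m hm.ne_top⟩

/-! ### Reduction to finitely generated domains -/

/-- The zero set of a solution over any field has a rational density, provided the last coefficient
of the recurrence is nonzero. -/
theorem LinearRecurrence.IsSolution.exists_hasCountDensity_of_coeff_ne_zero
    {K : Type*} [Field K] {E : LinearRecurrence K} {f : ℕ → K} (hf : E.IsSolution f)
    (hE : ∀ h : 0 < E.order, E.coeffs ⟨0, h⟩ ≠ 0) :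
    ∃ q : ℚ, HasCountDensity {n | f n = 0} (q : ℝ) := by
  -- Adjoining the inverses makes the last coefficient a unit of `R`.
  let s : Set K := Set.range E.coeffs ∪ Set.range (fun i => (E.coeffs i)⁻¹) ∪
    Set.range (fun i : Fin E.order => f i)
  have hs : s.Finite := ((Set.finite_range _).union (Set.finite_range _)).union (Set.finite_range _)
  let R := Algebra.adjoin ℤ s
  have : Algebra.FiniteType ℤ R := (Subalgebra.fg_iff_finiteType _).1
    (Subalgebra.fg_def.2 ⟨s, hs, rfl⟩)
  have hc : ∀ i, E.coeffs i ∈ R := fun i => Algebra.subset_adjoin (Or.inl (Or.inl ⟨i, rfl⟩))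
  have hc' : ∀ i, (E.coeffs i)⁻¹ ∈ R := fun i => Algebra.subset_adjoin (Or.inl (Or.inr ⟨i, rfl⟩))
  have hfR : ∀ n, f n ∈ R := by
    intro n
    induction n using Nat.strong_induction_on with
    | _ n ih =>
      rcases lt_or_ge n E.order with hn | hn
      · exact Algebra.subset_adjoin (Or.inr ⟨⟨n, hn⟩, rfl⟩)
      · obtain ⟨m, rfl⟩ := Nat.exists_eq_add_of_le' hn
        rw [hf m]
        exact sum_mem fun i _ => mul_mem (hc i) (ih _ (by omega))
  let F : LinearRecurrence R := ⟨E.order, fun i => ⟨E.coeffs i, hc i⟩⟩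
  let g : ℕ → R := fun n => ⟨f n, hfR n⟩
  have hg : F.IsSolution g := fun n => by
    apply Subtype.ext
    change f (n + E.order) = _
    rw [hf n]
    simp [F, g]
  have hF : ∀ h : 0 < F.order, IsUnit (F.coeffs ⟨0, h⟩) := fun h =>
    IsUnit.of_mul_eq_one ⟨_, hc' ⟨0, h⟩⟩ (Subtype.ext (mul_inv_cancel₀ (hE h)))
  have hg0 : ∀ n, g n = 0 ↔ f n = 0 := fun n => by simp [g, Subtype.ext_iff]
  obtain ⟨I, hI, hfin, hinf⟩ := exists_antitone_ideal_of_finiteType_int R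
  obtain ⟨D, hD, hmod⟩ := hf.exists_modulus
  have := hg.exists_hasCountDensity_of_residuallyFinite hF hI hinf hD (by simpa only [hg0])
  simpa only [hg0] using this

/-- If the coefficient of the oldest term vanishes, the sequence shifted by one obeys a recurrence
of smaller order, and a shift does not affect density. -/
theorem LinearRecurrence.IsSolution.exists_hasCountDensity
    {K : Type*} [Field K] {E : LinearRecurrence K} {f : ℕ → K} (hf : E.IsSolution f) :
    ∃ q : ℚ, HasCountDensity {n | f n = 0} (q : ℝ) := by
  obtain ⟨h, c⟩ := E
  induction h generalizing f with
  | zero => exact hf.exists_hasCountDensity_of_coeff_ne_zero fun h => absurd h (lt_irrefl 0)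
  | succ h ih =>
    by_cases h0 : c 0 = 0
    · have h1 : ∀ n, f (n + (h + 1)) = ∑ i : Fin (h + 1), c i * f (n + i) := hf
      have h2 : IsSolution ⟨h, fun i => c i.succ⟩ (fun n => f (n + 1)) := by
        intro n
        change f (n + h + 1) = ∑ i : Fin h, c i.succ * f (n + i + 1)
        simp only [add_assoc, h1, Fin.sum_univ_succ, h0, zero_mul, zero_add, Fin.val_succ]
      obtain ⟨q, hq⟩ := ih _ h2
      exact ⟨q, HasCountDensity.of_shift (s := 1) hq⟩
    · exact hf.exists_hasCountDensity_of_coeff_ne_zero fun _ => h0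

theorem mainTheorem4 (E : LinearRecurrence ℝ) (f : ℕ → ℝ) (hf : E.IsSolution f) :
    ∃ q : ℚ, HasNaturalDensity {n : ℕ | f n = 0} (q : ℝ) := by
  obtain ⟨q, hq⟩ := hf.exists_hasCountDensity
  exact ⟨q, hq.hasNaturalDensity⟩
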